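/- Let $\beta>1$ and let $T_\beta:[0,1]\to[0,1]$ be the beta-transformation $T_\beta(x)=\beta x-\lfloor\beta x\rfloor$. Let $L:[0,1]\to[0,1]$ be a Lipschitz function and let $\varphi:\mathbb N\to(0,1]$, where $\mathbb N=\{1,2,3,\dots\}$. Then the set $$\mathfrak R_\beta(L,\varphi)=\{x\in[0,1] : |T_\beta^n x-L(x)|<\varphi(n)\text{ for infinitely many } n\in\mathbb N\}$$ is Lebesgue measurable, and its Lebesgue measure is $0$ if $\sum_{n\ge1}\varphi(n)<+\infty$ and $1$ if $\sum_{n\ge1}\varphi(n)=+\infty$. -/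

import Mathlib

open Set Filter MeasureTheory
open scoped NNReal

/-- The beta-transformation `x ↦ βx - ⌊βx⌋`; it maps `[0,1]` into `[0,1]` when `β > 1`. -/
noncomputable def betaMap (β x : ℝ) : ℝ := β * x - (⌊β * x⌋ : ℝ)

/-- The points `x ∈ [0,1]` with `|T_β^n x - L x| < φ n` for infinitely many `n`. -/
def recurrenceSet (β : ℝ) (L : ℝ → ℝ) (φ : ℕ → ℝ) : Set ℝ :=
  {x | x ∈ Icc (0 : ℝ) 1 ∧ {n : ℕ | 1 ≤ n ∧ |(betaMap β)^[n] x - L x| < φ n}.Infinite}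

/-! Let A_n be the set of x with |T^n x - g x| < φ n, where g extends L. The proof is a
Borel–Cantelli argument with estimates on every interval, and it uses no invariant density or mixing
theorem.

On a branch of T the substitution x = (i + y)/β turns a hitting problem for (T^(n+1), g) into one
for T^n and the slower function y ↦ g((i + y)/β), at the cost of a factor 1/β (`hitVol_branch`).
Bounds at time 0, valid for a class of functions stable under this substitution, therefore propagate
by induction to time n. The incomplete branches at the ends of an interval cost only (n + 1)β^(-n)
(`hitVol_le`, `exists_le_hitVol`).

At time 0 the geometry is elementary. If g is 1/2-Lipschitz, the points with |x - g x| < r lie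
within 4r of each other; if g maps into [0,1], it has a fixed point, near which x is close to g x.
Hence |A_n ∩ I| is comparable to φ n |I| for large n. Applying the upper bound twice controls pairs:
|A_m ∩ A_(m+l) ∩ I| is at most a constant times φ(m+l)(φ m + e_l)|I|, with e_l = (l + 1)β^(-l)
summable.

Convergence gives measure 0 by Borel–Cantelli. Under divergence, Chung–Erdős shows that every tail
union of the A_n fills a fixed proportion of every interval, and Lebesgue density makes it full
(`volume_Icc_sdiff_frequently_eq_zero`). -/

/-- The points of `[a, b)` at which the pair `(T_β^n x, g x)` lies in `D`. -/
def hitSet (β : ℝ) (D : Set (ℝ × ℝ)) (n : ℕ) (g : ℝ → ℝ) (a b : ℝ) : Set ℝ :=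
  {x | x ∈ Ico a b ∧ ((betaMap β)^[n] x, g x) ∈ D}

/-- The length of `hitSet`. -/
noncomputable def hitVol (β : ℝ) (D : Set (ℝ × ℝ)) (n : ℕ) (g : ℝ → ℝ) (a b : ℝ) : ℝ :=
  volume.real (hitSet β D n g a b)

/-! ### Cutting intervals along the branches of T -/

section branches

variable {β : ℝ} {D : Set (ℝ × ℝ)} {n : ℕ} {g : ℝ → ℝ} {a b c : ℝ}

theorem hitVol_nonneg : 0 ≤ hitVol β D n g a b := measureReal_nonneg

theorem hitSet_volume_ne_top : volume (hitSet β D n g a b) ≠ ⊤ :=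
  ((measure_mono (fun _ hx => hx.1)).trans_lt (measure_Ico_lt_top (a := a) (b := b))).ne

theorem ofReal_hitVol : ENNReal.ofReal (hitVol β D n g a b) = volume (hitSet β D n g a b) :=
  ENNReal.ofReal_toReal hitSet_volume_ne_top

theorem hitVol_add (hab : a ≤ b) (hbc : b ≤ c) :
    hitVol β D n g a c = hitVol β D n g a b + hitVol β D n g b c := by
  have h := measureReal_inter_add_sdiff (μ := volume) (s := hitSet β D n g a c)
    (measurableSet_Iio (a := b)) hitSet_volume_ne_top
  have h1 : hitSet β D n g a c ∩ Iio b = hitSet β D n g a b := by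
    ext x
    simp only [hitSet, mem_inter_iff, mem_ofPred_eq, mem_Ico, mem_Iio]
    constructor
    · rintro ⟨⟨⟨h1, h2⟩, h3⟩, h4⟩; exact ⟨⟨h1, h4⟩, h3⟩
    · rintro ⟨⟨h1, h2⟩, h3⟩; exact ⟨⟨⟨h1, h2.trans_le hbc⟩, h3⟩, h2⟩
  have h2 : hitSet β D n g a c \ Iio b = hitSet β D n g b c := by
    ext x
    simp only [hitSet, Set.mem_sdiff, mem_ofPred_eq, mem_Ico, mem_Iio, not_lt]
    constructor
    · rintro ⟨⟨⟨h1, h2⟩, h3⟩, h4⟩; exact ⟨⟨h4, h2⟩, h3⟩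
    · rintro ⟨⟨h1, h2⟩, h3⟩; exact ⟨⟨⟨hab.trans h1, h2⟩, h3⟩, h1⟩
  rw [h1, h2] at h
  exact h.symm

theorem betaMap_branch (hβ : 0 < β) (i : ℤ) {y : ℝ} (hy : y ∈ Ico (0 : ℝ) 1) :
    betaMap β ((i + y) / β) = y := by
  have h : β * ((i + y) / β) = i + y := by field_simp
  have h2 : ⌊(i : ℝ) + y⌋ = i := by
    rw [Int.floor_eq_iff]; exact ⟨by linarith [hy.1], by linarith [hy.2]⟩
  rw [betaMap, h, h2]; ring

theorem betaMap_mem_Ico (x : ℝ) : betaMap β x ∈ Ico (0 : ℝ) 1 :=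
  ⟨Int.fract_nonneg (β * x), Int.fract_lt_one (β * x)⟩

/-- The affine map y ↦ (i + y)/β is inverted by T on [0, 1), so one iterate is used up and lengths
shrink by β. -/
theorem hitVol_branch (hβ : 0 < β) (i : ℤ) {s t : ℝ} (hs : 0 ≤ s) (ht : t ≤ 1) :
    hitVol β D (n + 1) g ((i + s) / β) ((i + t) / β)
      = β⁻¹ * hitVol β D n (fun y => g ((i + y) / β)) s t := by
  have key : hitSet β D n (fun y => g ((i + y) / β)) s t
      = (fun y => β⁻¹ * y) ⁻¹' ((fun x => i / β + x) ⁻¹'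
          hitSet β D (n + 1) g ((i + s) / β) ((i + t) / β)) := by
    ext y
    have e : (i : ℝ) / β + β⁻¹ * y = (i + y) / β := by field_simp
    simp only [hitSet, mem_ofPred_eq, mem_preimage, e, mem_Ico]
    rw [div_le_div_iff_of_pos_right hβ, div_lt_div_iff_of_pos_right hβ]
    simp only [add_le_add_iff_left, add_lt_add_iff_left]
    refine and_congr_right fun hy => ?_
    rw [Function.iterate_succ_apply, betaMap_branch hβ i ⟨hs.trans hy.1, hy.2.trans_le ht⟩]
  unfold hitVol
  rw [key, measureReal_def, measureReal_def, Real.volume_preimage_mul_left (inv_ne_zero hβ.ne'),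
    measure_preimage_add, ENNReal.toReal_mul, inv_inv, abs_of_pos hβ,
    ENNReal.toReal_ofReal hβ.le, ← mul_assoc, inv_mul_cancel₀ hβ.ne', one_mul]

theorem hitVol_branches_le (hβ : 0 < β) {M : ℝ}
    (h : ∀ i : ℤ, hitVol β D n (fun y => g ((i + y) / β)) 0 1 ≤ M) (p : ℤ) (k : ℕ) :
    hitVol β D (n + 1) g (p / β) ((p + k) / β) ≤ k * (β⁻¹ * M) := by
  induction k with
  | zero => simp [hitVol, hitSet]
  | succ k ih =>
    rw [hitVol_add (b := (p + k) / β) (by gcongr; simp) (by gcongr; simp)]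
    have h1 := hitVol_branch (D := D) (n := n) (g := g) hβ (p + k) le_rfl (le_refl (1 : ℝ))
    have h2 := mul_le_mul_of_nonneg_left (h (p + k)) (inv_pos.2 hβ).le
    push_cast at h1 h2 ⊢
    rw [add_zero, add_assoc] at h1
    linarith

theorem le_hitVol_branches (hβ : 0 < β) {M : ℝ}
    (h : ∀ i : ℤ, M ≤ hitVol β D n (fun y => g ((i + y) / β)) 0 1) (p : ℤ) (k : ℕ) :
    k * (β⁻¹ * M) ≤ hitVol β D (n + 1) g (p / β) ((p + k) / β) := by
  induction k with
  | zero => simpa using hitVol_nonneg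
  | succ k ih =>
    rw [hitVol_add (b := (p + k) / β) (by gcongr; simp) (by gcongr; simp)]
    have h1 := hitVol_branch (D := D) (n := n) (g := g) hβ (p + k) le_rfl (le_refl (1 : ℝ))
    have h2 := mul_le_mul_of_nonneg_left (h (p + k)) (inv_pos.2 hβ).le
    push_cast at h1 h2 ⊢
    rw [add_zero, add_assoc] at h1
    linarith

/-- Splitting `[0, c)` into full branches and the last, partial one. -/
theorem hitVol_zero_split (hβ : 0 < β) (hc : 0 ≤ c) :
    ∃ k : ℕ, β * c = k + betaMap β c ∧
      hitVol β D (n + 1) g 0 c = hitVol β D (n + 1) g ((0 : ℤ) / β) (((0 : ℤ) + k) / β)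
        + β⁻¹ * hitVol β D n (fun y => g (((k : ℤ) + y) / β)) 0 (betaMap β c) := by
  have hk : ((⌊β * c⌋.toNat : ℕ) : ℤ) = ⌊β * c⌋ :=
    Int.toNat_of_nonneg (Int.floor_nonneg.2 (by positivity))
  have hk' : ((⌊β * c⌋.toNat : ℕ) : ℝ) = ⌊β * c⌋ := by exact_mod_cast hk
  have e : β * c = (⌊β * c⌋.toNat : ℕ) + betaMap β c := by rw [hk', betaMap]; ring
  refine ⟨⌊β * c⌋.toNat, e, ?_⟩
  set k := ⌊β * c⌋.toNat
  have hT := betaMap_mem_Ico (β := β) c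
  rw [← hitVol_branch hβ _ le_rfl hT.2.le]
  have e2 : c = (((k : ℤ) : ℝ) + betaMap β c) / β := by
    push_cast; rw [← e]; field_simp
  rw [← e2, hitVol_add (b := (k : ℝ) / β) (by positivity)]
  · simp
  · rw [div_le_iff₀ hβ]; nlinarith [hT.1]

/-- An interval either lies in one branch, or consists of the end of a branch, some full
branches, and the beginning of a branch. -/
theorem hitVol_split (hβ : 0 < β) (hab : a ≤ b) :
    (∃ i : ℤ, betaMap β a ≤ betaMap β b ∧ β * (b - a) = betaMap β b - betaMap β a ∧
      hitVol β D (n + 1) g a b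
        = β⁻¹ * hitVol β D n (fun y => g ((i + y) / β)) (betaMap β a) (betaMap β b)) ∨
    (∃ i j : ℤ, ∃ k : ℕ, β * (b - a) = (1 - betaMap β a) + k + betaMap β b ∧
      hitVol β D (n + 1) g a b
        = β⁻¹ * hitVol β D n (fun y => g (((i : ℤ) + y) / β)) (betaMap β a) 1
        + hitVol β D (n + 1) g (((i + 1 : ℤ) : ℝ) / β) ((((i + 1 : ℤ) : ℝ) + k) / β)
        + β⁻¹ * hitVol β D n (fun y => g (((j : ℤ) + y) / β)) 0 (betaMap β b)) := by
  have hTa := betaMap_mem_Ico (β := β) a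
  have hTb := betaMap_mem_Ico (β := β) b
  have ea : a = ((⌊β * a⌋ : ℝ) + betaMap β a) / β := by rw [betaMap]; field_simp; ring
  have eb : b = ((⌊β * b⌋ : ℝ) + betaMap β b) / β := by rw [betaMap]; field_simp; ring
  have ea' : β * a = (⌊β * a⌋ : ℝ) + betaMap β a := by rw [betaMap]; ring
  have eb' : β * b = (⌊β * b⌋ : ℝ) + betaMap β b := by rw [betaMap]; ring
  have hle : β * a ≤ β * b := by gcongr
  rcases (Int.floor_le_floor hle).eq_or_lt with h | h
  · left
    refine ⟨⌊β * a⌋, ?_, ?_, ?_⟩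
    · rw [betaMap, betaMap, h]; linarith
    · rw [betaMap, betaMap, h]; ring
    · rw [← hitVol_branch hβ _ hTa.1 hTb.2.le, ← ea, h, ← eb]
  · right
    have hk : ((⌊β * b⌋ - (⌊β * a⌋ + 1)).toNat : ℤ) = ⌊β * b⌋ - (⌊β * a⌋ + 1) :=
      Int.toNat_of_nonneg (by omega)
    have hk' : ((⌊β * b⌋ - (⌊β * a⌋ + 1)).toNat : ℝ) = ⌊β * b⌋ - (⌊β * a⌋ + 1) := by
      exact_mod_cast hk
    refine ⟨⌊β * a⌋, ⌊β * b⌋, (⌊β * b⌋ - (⌊β * a⌋ + 1)).toNat, ?_, ?_⟩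
    · rw [hk', mul_sub, ea', eb']; simp only [betaMap]; ring_nf
    · rw [← hitVol_branch hβ _ hTa.1 le_rfl, ← hitVol_branch hβ _ le_rfl hTb.2.le, ← ea, ← eb, hk']
      have e3 : (((⌊β * a⌋ + 1 : ℤ) : ℝ) + ((⌊β * b⌋ : ℝ) - (⌊β * a⌋ + 1))) / β
          = (⌊β * b⌋ + 0) / β := by
        congr 1; push_cast; ring
      have h' : (⌊β * a⌋ : ℝ) + 1 ≤ ⌊β * b⌋ := by exact_mod_cast h
      rw [e3]
      push_cast
      have l1 : a ≤ ((⌊β * a⌋ : ℝ) + 1) / β := by rw [le_div_iff₀ hβ]; linarith [hTa.2]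
      have l2 : ((⌊β * a⌋ : ℝ) + 1) / β ≤ (⌊β * b⌋ + 0) / β :=
        div_le_div_of_nonneg_right (by linarith) hβ.le
      have l3 : ((⌊β * b⌋ : ℝ) + 0) / β ≤ b := by rw [div_le_iff₀ hβ]; linarith [hTb.1]
      rw [hitVol_add l1 (l2.trans l3), hitVol_add l2 l3]
      ring

end branches

/-! ### Propagating bounds from time 0 to time n -/

section bounds

variable {β : ℝ} {D : Set (ℝ × ℝ)} {G : ℕ → (ℝ → ℝ) → Prop}

/-- Initial intervals are closed under the recursion: [0, c) is a run of full branches followed by a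
partial branch that T maps onto [0, T c). The predicate G is any class of functions stable under
passing to a branch. -/
theorem hitVol_zero_le (hβ : 1 < β) {R : ℝ} (hR : 0 ≤ R)
    (hG : ∀ n g (i : ℤ), G (n + 1) g → G n (fun y => g ((i + y) / β)))
    (base : ∀ g a b, G 0 g → 0 ≤ a → a ≤ b → b ≤ 1 → hitVol β D 0 g a b ≤ R)
    (n : ℕ) : ∀ (g : ℝ → ℝ) (c : ℝ), G n g → 0 ≤ c → c ≤ 1 →
      hitVol β D n g 0 c ≤ R * ((∑ j ∈ Finset.range n, β⁻¹ ^ j) * c + β⁻¹ ^ n) := by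
  have hβ0 : 0 < β := by linarith
  induction n with
  | zero => intro g c hg h0 h1; simpa using base g 0 c hg le_rfl h0 h1
  | succ n ih =>
    intro g c hg h0 h1
    obtain ⟨k, hk, e⟩ := hitVol_zero_split (D := D) (n := n) (g := g) hβ0 h0
    have hT := betaMap_mem_Ico (β := β) c
    have hfull : ∀ i : ℤ, hitVol β D n (fun y => g ((i + y) / β)) 0 1
        ≤ R * (∑ j ∈ Finset.range (n + 1), β⁻¹ ^ j) := by
      intro i
      have := ih _ 1 (hG n g i hg) zero_le_one le_rfl
      -- For c = 1 the error β^(-n) is exactly the next term of the geometric sum.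
      rwa [mul_one, ← Finset.sum_range_succ] at this
    have h2 := hitVol_branches_le hβ0 hfull 0 k
    have h3 := mul_le_mul_of_nonneg_left (ih _ _ (hG n g k hg) hT.1 hT.2.le) (inv_pos.2 hβ0).le
    rw [e]
    have hS : (∑ j ∈ Finset.range n, β⁻¹ ^ j) ≤ ∑ j ∈ Finset.range (n + 1), β⁻¹ ^ j := by
      rw [Finset.sum_range_succ]; linarith [show (0 : ℝ) ≤ β⁻¹ ^ n by positivity]
    set S := ∑ j ∈ Finset.range n, β⁻¹ ^ j
    set S' := ∑ j ∈ Finset.range (n + 1), β⁻¹ ^ j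
    have hc : c = β⁻¹ * (k + betaMap β c) := by rw [← hk]; field_simp
    have h4 : R * (S' * c + β⁻¹ ^ (n + 1)) =
        k * (β⁻¹ * (R * S')) + β⁻¹ * (R * (S' * betaMap β c + β⁻¹ ^ n)) := by
      nth_rw 1 [hc]; ring
    have h5 : β⁻¹ * (R * (S * betaMap β c + β⁻¹ ^ n))
        ≤ β⁻¹ * (R * (S' * betaMap β c + β⁻¹ ^ n)) := by
      have := hT.1
      gcongr
    rw [h4]
    linarith

theorem sum_inv_pow_le (hβ : 1 < β) (n : ℕ) :
    ∑ j ∈ Finset.range n, β⁻¹ ^ j ≤ (1 - β⁻¹)⁻¹ := by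
  have h1 : β⁻¹ < 1 := inv_lt_one_of_one_lt₀ hβ
  have h0 : 0 ≤ β⁻¹ := by positivity
  rw [← tsum_geometric_of_lt_one h0 h1]
  exact (summable_geometric_of_lt_one h0 h1).sum_le_tsum _ (fun i _ => by positivity)

/-- A bound for a set of pairs at time `0` gives a bound at time `n`. -/
theorem hitVol_le (hβ : 1 < β) {R : ℝ} (hR : 0 ≤ R)
    (hG : ∀ n g (i : ℤ), G (n + 1) g → G n (fun y => g ((i + y) / β)))
    (base : ∀ g a b, G 0 g → 0 ≤ a → a ≤ b → b ≤ 1 → hitVol β D 0 g a b ≤ R)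
    (n : ℕ) : ∀ (g : ℝ → ℝ) (a b : ℝ), G n g → 0 ≤ a → a ≤ b → b ≤ 1 →
      hitVol β D n g a b ≤ R * ((1 - β⁻¹)⁻¹ * (b - a) + (n + 1) * β⁻¹ ^ n) := by
  have hβ0 : 0 < β := by linarith
  have h1 : β⁻¹ < 1 := inv_lt_one_of_one_lt₀ hβ
  have hC : 0 < (1 - β⁻¹)⁻¹ := by rw [inv_pos]; linarith
  have hz : ∀ n, ∀ (g : ℝ → ℝ) (c : ℝ), G n g → 0 ≤ c → c ≤ 1 →
      hitVol β D n g 0 c ≤ R * ((1 - β⁻¹)⁻¹ * c + β⁻¹ ^ n) := by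
    intro n g c hg h0 h1
    refine (hitVol_zero_le hβ hR hG base n g c hg h0 h1).trans ?_
    have := sum_inv_pow_le hβ n
    gcongr
  have hf : ∀ n, ∀ (g : ℝ → ℝ), G n g → hitVol β D n g 0 1 ≤ R * (1 - β⁻¹)⁻¹ := by
    intro n g hg
    refine (hitVol_zero_le hβ hR hG base n g 1 hg zero_le_one le_rfl).trans ?_
    rw [mul_one, ← Finset.sum_range_succ]
    exact mul_le_mul_of_nonneg_left (sum_inv_pow_le hβ _) hR
  induction n with
  | zero =>
    intro g a b hg h0 hab h1
    refine (base g a b hg h0 hab h1).trans (le_mul_of_one_le_right hR ?_)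
    have : 0 ≤ (1 - β⁻¹)⁻¹ * (b - a) := mul_nonneg hC.le (by linarith)
    simpa using this
  | succ n ih =>
    intro g a b hg h0 hab h1
    have hTa := betaMap_mem_Ico (β := β) a
    have hTb := betaMap_mem_Ico (β := β) b
    have hi := (inv_pos.2 hβ0).le
    have hp : 0 ≤ β⁻¹ ^ n := by positivity
    rcases hitVol_split (D := D) (n := n) (g := g) hβ0 hab with
      ⟨i, hle, hk, e⟩ | ⟨i, j, k, hk, e⟩
    · rw [e]
      refine (mul_le_mul_of_nonneg_left (ih _ _ _ (hG n g i hg) hTa.1 hle hTb.2.le) hi).trans ?_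
      have hba : b - a = β⁻¹ * (betaMap β b - betaMap β a) := by rw [← hk]; field_simp
      rw [hba, ← sub_nonneg]
      have : 0 ≤ R * (β⁻¹ * β⁻¹ ^ n) := by positivity
      refine this.trans_eq ?_
      push_cast
      ring
    · rw [e]
      have q1 := mul_le_mul_of_nonneg_left (ih _ _ _ (hG n g i hg) hTa.1 hTa.2.le le_rfl) hi
      have q2 := hitVol_branches_le hβ0 (fun i => hf n _ (hG n g i hg)) (i + 1) k
      have q3 := mul_le_mul_of_nonneg_left (hz n _ _ (hG n g j hg) hTb.1 hTb.2.le) hi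
      -- The left end carries the error (n + 1)β^(-n), the full branches none, the right end β^(-n).
      -- Their total over β is (n + 2)β^(-(n+1)).
      refine (add_le_add (add_le_add q1 q2) q3).trans (le_of_eq ?_)
      have hba : b - a = β⁻¹ * ((1 - betaMap β a) + k + betaMap β b) := by rw [← hk]; field_simp
      rw [hba]
      push_cast; ring

/-- The same recursion from below. A full interval loses a factor 1 - β^(-(n+1)) at each step,
whence the product. -/
theorem le_hitVol_zero (hβ : 1 < β) {ρ : ℝ} (hρ : 0 ≤ ρ)
    (hG : ∀ n g (i : ℤ), G (n + 1) g → G n (fun y => g ((i + y) / β)))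
    (base : ∀ g, G 0 g → ρ ≤ hitVol β D 0 g 0 1)
    (n : ℕ) : ∀ (g : ℝ → ℝ), G n g →
      ρ * (∏ j ∈ Finset.range n, (1 - β⁻¹ ^ (j + 1))) ≤ hitVol β D n g 0 1 ∧
      ∀ c, 0 ≤ c → c ≤ 1 → ρ * ((∏ j ∈ Finset.range n, (1 - β⁻¹ ^ (j + 1))) * (c - β⁻¹ ^ n))
        ≤ hitVol β D n g 0 c := by
  have hβ0 : 0 < β := by linarith
  have hi := (inv_pos.2 hβ0).le
  have h1 : β⁻¹ ≤ 1 := (inv_lt_one_of_one_lt₀ hβ).le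
  induction n with
  | zero =>
    intro g hg
    refine ⟨by simpa using base g hg, fun c h0 h1 => le_trans ?_ hitVol_nonneg⟩
    simp only [Finset.range_zero, Finset.prod_empty, pow_zero, one_mul]
    exact mul_nonpos_of_nonneg_of_nonpos hρ (by linarith)
  | succ n ih =>
    intro g hg
    rw [Finset.prod_range_succ]
    set m := ∏ j ∈ Finset.range n, (1 - β⁻¹ ^ (j + 1))
    have hm : 0 ≤ m := Finset.prod_nonneg fun j _ => sub_nonneg.2 (pow_le_one₀ hi h1)
    have hx1 : β⁻¹ ^ (n + 1) ≤ 1 := pow_le_one₀ hi h1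
    have hx0 : 0 ≤ β⁻¹ ^ (n + 1) := by positivity
    have key : ∀ c, 0 ≤ c → c ≤ 1 →
        ρ * (m * (c - β⁻¹ ^ (n + 1))) ≤ hitVol β D (n + 1) g 0 c := by
      intro c h0 h1
      obtain ⟨k, hk, e⟩ := hitVol_zero_split (D := D) (n := n) (g := g) hβ0 h0
      have hT := betaMap_mem_Ico (β := β) c
      have h2 := le_hitVol_branches hβ0 (fun i => (ih _ (hG n g i hg)).1) 0 k
      have h3 := mul_le_mul_of_nonneg_left ((ih _ (hG n g k hg)).2 _ hT.1 hT.2.le) hi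
      rw [e]
      refine le_trans (le_of_eq ?_) (add_le_add h2 h3)
      have hc : c = β⁻¹ * (k + betaMap β c) := by rw [← hk]; field_simp
      nth_rw 1 [hc]
      ring
    refine ⟨?_, fun c h0 h1 => ?_⟩
    · exact key 1 zero_le_one le_rfl
    -- Shrinking the product weakens the bound only when c - β^(-(n+1)) is nonnegative; otherwise
    -- the bound is trivial.
    · rcases le_total 0 (c - β⁻¹ ^ (n + 1)) with h | h
      · refine le_trans ?_ (key c h0 h1)
        gcongr
        exact mul_le_of_le_one_right hm (by linarith)
      · refine le_trans (mul_nonpos_of_nonneg_of_nonpos hρ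
          (mul_nonpos_of_nonneg_of_nonpos (mul_nonneg hm (by linarith)) h)) hitVol_nonneg

/-- From 1/(1 - x) = 1 + x/(1 - x) ≤ exp(x/(1 - x)) each factor is at least an exponential, and the
exponents are dominated by a geometric series. -/
theorem exists_le_prod_one_sub_inv_pow (hβ : 1 < β) :
    ∃ m : ℝ, 0 < m ∧ m ≤ 1 ∧ ∀ n, m ≤ ∏ j ∈ Finset.range n, (1 - β⁻¹ ^ (j + 1)) := by
  have hβ0 : 0 < β := by linarith
  have h1 : β⁻¹ < 1 := inv_lt_one_of_one_lt₀ hβ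
  have h0 : 0 < β⁻¹ := by positivity
  have hd : 0 < 1 - β⁻¹ := by linarith
  have hterm : ∀ j, Real.exp (-(β⁻¹ ^ j * (1 - β⁻¹)⁻¹)) ≤ 1 - β⁻¹ ^ (j + 1) := by
    intro j
    have hx : β⁻¹ ^ (j + 1) ≤ β⁻¹ := pow_le_of_le_one h0.le h1.le (by simp)
    have hx0 : 0 < 1 - β⁻¹ ^ (j + 1) := by linarith
    rw [Real.exp_neg, inv_le_comm₀ (Real.exp_pos _) hx0]
    refine le_trans ?_ (Real.add_one_le_exp _)
    have hle : (1 - β⁻¹ ^ (j + 1))⁻¹ ≤ (1 - β⁻¹)⁻¹ := by gcongr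
    have e : (1 - β⁻¹ ^ (j + 1))⁻¹ = β⁻¹ ^ (j + 1) * (1 - β⁻¹ ^ (j + 1))⁻¹ + 1 := by
      linear_combination mul_inv_cancel₀ hx0.ne'
    rw [e]
    have : β⁻¹ ^ (j + 1) ≤ β⁻¹ ^ j := pow_le_pow_of_le_one h0.le h1.le (by simp)
    gcongr
  refine ⟨Real.exp (-((1 - β⁻¹)⁻¹ * (1 - β⁻¹)⁻¹)), Real.exp_pos _, ?_, fun n => ?_⟩
  · rw [Real.exp_le_one_iff, neg_nonpos]; positivity
  · refine le_trans ?_ (Finset.prod_le_prod (fun j _ => (Real.exp_pos _).le) (fun j _ => hterm j))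
    rw [← Real.exp_sum, Real.exp_le_exp, Finset.sum_neg_distrib, neg_le_neg_iff, ← Finset.sum_mul]
    have := sum_inv_pow_le hβ n
    gcongr

/-- A lower bound on the unit interval at time `0` gives a lower bound at time `n`. -/
theorem exists_le_hitVol (hβ : 1 < β) : ∃ m : ℝ, 0 < m ∧
    ∀ (D : Set (ℝ × ℝ)) (G : ℕ → (ℝ → ℝ) → Prop) (ρ : ℝ), 0 ≤ ρ →
    (∀ n g (i : ℤ), G (n + 1) g → G n (fun y => g ((i + y) / β))) →
    (∀ g, G 0 g → ρ ≤ hitVol β D 0 g 0 1) →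
    ∀ (n : ℕ) (g : ℝ → ℝ) (a b : ℝ), G n g → 0 ≤ a → a ≤ b → b ≤ 1 →
      ρ * (m * (b - a) - (n + 1) * β⁻¹ ^ n) ≤ hitVol β D n g a b := by
  -- The constant m depends on β alone, hence will be uniform in the radius of the target.
  obtain ⟨m, hm0, hm1, hm⟩ := exists_le_prod_one_sub_inv_pow hβ
  refine ⟨m, hm0, fun D G ρ hρ hG base => ?_⟩
  have hβ0 : 0 < β := by linarith
  have hi := (inv_pos.2 hβ0).le
  have hf : ∀ n, ∀ (g : ℝ → ℝ), G n g → ρ * m ≤ hitVol β D n g 0 1 := fun n g hg =>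
    (mul_le_mul_of_nonneg_left (hm n) hρ).trans (le_hitVol_zero hβ hρ hG base n g hg).1
  have hz : ∀ n, ∀ (g : ℝ → ℝ) (c : ℝ), G n g → 0 ≤ c → c ≤ 1 →
      ρ * (m * c - β⁻¹ ^ n) ≤ hitVol β D n g 0 c := by
    intro n g c hg h0 h1
    have hp : 0 ≤ β⁻¹ ^ n := by positivity
    have h2 : m * c - β⁻¹ ^ n ≤ m * (c - β⁻¹ ^ n) := by nlinarith
    rcases le_total 0 (c - β⁻¹ ^ n) with h | h
    · refine le_trans ?_ ((le_hitVol_zero hβ hρ hG base n g hg).2 c h0 h1)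
      exact mul_le_mul_of_nonneg_left
        (h2.trans (mul_le_mul_of_nonneg_right (hm n) h)) hρ
    · refine le_trans (mul_nonpos_of_nonneg_of_nonpos hρ (h2.trans ?_)) hitVol_nonneg
      exact mul_nonpos_of_nonneg_of_nonpos hm0.le h
  intro n
  induction n with
  | zero =>
    intro g a b hg h0 hab h1
    refine le_trans (mul_nonpos_of_nonneg_of_nonpos hρ ?_) hitVol_nonneg
    simp only [CharP.cast_eq_zero, zero_add, pow_zero, mul_one]
    nlinarith
  | succ n ih =>
    intro g a b hg h0 hab h1
    have hTa := betaMap_mem_Ico (β := β) a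
    have hTb := betaMap_mem_Ico (β := β) b
    have hp : 0 ≤ β⁻¹ ^ n := by positivity
    rcases hitVol_split (D := D) (n := n) (g := g) hβ0 hab with
      ⟨i, hle, hk, e⟩ | ⟨i, j, k, hk, e⟩
    · rw [e]
      refine le_trans ?_
        (mul_le_mul_of_nonneg_left (ih _ _ _ (hG n g i hg) hTa.1 hle hTb.2.le) hi)
      have hba : b - a = β⁻¹ * (betaMap β b - betaMap β a) := by rw [← hk]; field_simp
      rw [hba, ← sub_nonneg]
      have : 0 ≤ ρ * (β⁻¹ * β⁻¹ ^ n) := by positivity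
      refine this.trans_eq ?_
      push_cast
      ring
    · rw [e]
      have q1 := mul_le_mul_of_nonneg_left (ih _ _ _ (hG n g i hg) hTa.1 hTa.2.le le_rfl) hi
      have q2 := le_hitVol_branches hβ0 (fun i => hf n _ (hG n g i hg)) (i + 1) k
      have q3 := mul_le_mul_of_nonneg_left (hz n _ _ (hG n g j hg) hTb.1 hTb.2.le) hi
      refine le_trans (le_of_eq ?_) (add_le_add (add_le_add q1 q2) q3)
      have hba : b - a = β⁻¹ * ((1 - betaMap β a) + k + betaMap β b) := by rw [← hk]; field_simp
      rw [hba]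
      push_cast; ring

end bounds

/-! ### Shrinking targets: estimates at time 0 and their transfer -/

section targets

variable {β : ℝ} {g : ℝ → ℝ} {r s : ℝ}

/-- The pairs at distance less than `r`. -/
def nearSet (r : ℝ) : Set (ℝ × ℝ) := {p | |p.1 - p.2| < r}

/-- The pairs at distance less than `r`, and less than `s` after `l` steps of the first point. -/
def nearPairSet (β r s : ℝ) (l : ℕ) : Set (ℝ × ℝ) :=
  {p | |p.1 - p.2| < r ∧ |(betaMap β)^[l] p.1 - p.2| < s}

/-- Functions that vary at most half as fast as `T_β^n` on its branches. -/
def SlowAt (β : ℝ) (n : ℕ) (g : ℝ → ℝ) : Prop :=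
  ∀ x y, |g x - g y| ≤ β ^ n / 2 * |x - y|

/-- `K`-Lipschitz functions with values in `[0, 1]`. -/
def LipUnit (K : ℝ) (_n : ℕ) (g : ℝ → ℝ) : Prop :=
  (∀ x, g x ∈ Icc (0 : ℝ) 1) ∧ ∀ x y, |g x - g y| ≤ K * |x - y|

theorem abs_branch_sub (hβ : 0 < β) (i : ℤ) (x y : ℝ) :
    |(i + x) / β - (i + y) / β| = β⁻¹ * |x - y| := by
  rw [show (i + x) / β - (i + y) / β = β⁻¹ * (x - y) by field_simp; ring, abs_mul,
    abs_of_pos (inv_pos.2 hβ)]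

theorem SlowAt.branch (hβ : 0 < β) (n : ℕ) (g : ℝ → ℝ) (i : ℤ) (h : SlowAt β (n + 1) g) :
    SlowAt β n (fun y => g ((i + y) / β)) := by
  intro x y
  refine (h _ _).trans (le_of_eq ?_)
  rw [abs_branch_sub hβ, pow_succ]
  field_simp

theorem LipUnit.branch (hβ : 1 < β) {K : ℝ} (hK : 0 ≤ K) (n : ℕ) (g : ℝ → ℝ) (i : ℤ)
    (h : LipUnit K (n + 1) g) : LipUnit K n (fun y => g ((i + y) / β)) := by
  refine ⟨fun x => h.1 _, fun x y => (h.2 _ _).trans ?_⟩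
  rw [abs_branch_sub (by linarith)]
  exact mul_le_mul_of_nonneg_left
    (mul_le_of_le_one_left (abs_nonneg _) (inv_lt_one_of_one_lt₀ hβ).le) hK

theorem SlowAt.of_zero (hβ : 1 < β) (h : SlowAt β 0 g) (n : ℕ) : SlowAt β n g := by
  intro x y
  refine (h x y).trans ?_
  have : β ^ 0 ≤ β ^ n := pow_le_pow_right₀ hβ.le (Nat.zero_le n)
  gcongr

/-- At time 0 slowness means 1/2-Lipschitz, so |x - y| < 2r + |x - y|/2. -/
theorem abs_sub_lt_of_near (h : SlowAt β 0 g) {x y : ℝ} (hx : |x - g x| < r)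
    (hy : |y - g y| < r) : |x - y| < 4 * r := by
  have h1 := h x y
  have h2 : |x - y| ≤ |x - g x| + |g x - g y| + |y - g y| := by
    calc |x - y| = |(x - g x) + (g x - g y) + (g y - y)| := by ring_nf
      _ ≤ |x - g x| + |g x - g y| + |g y - y| := abs_add_three _ _ _
      _ = _ := by rw [abs_sub_comm (g y) y]
  rw [pow_zero] at h1
  linarith

theorem hitVol_near_zero_le (hr : 0 ≤ r) (g : ℝ → ℝ) (a b : ℝ) (h : SlowAt β 0 g) :
    hitVol β (nearSet r) 0 g a b ≤ 8 * r := by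
  rcases (hitSet β (nearSet r) 0 g a b).eq_empty_or_nonempty with h0 | ⟨y, hy⟩
  · rw [hitVol, h0, measureReal_empty]; positivity
  · have hsub : hitSet β (nearSet r) 0 g a b ⊆ Ioo (y - 4 * r) (y + 4 * r) := by
      intro x hx
      have : -(4 * r) < x - y ∧ x - y < 4 * r := abs_lt.1 (abs_sub_lt_of_near h hx.2 hy.2)
      exact ⟨by linarith [this.1], by linarith [this.2]⟩
    refine (measureReal_mono hsub (by simp)).trans ?_
    rw [Real.volume_real_Ioo_of_le (by linarith)]
    linarith

theorem hitVol_near_le (hβ : 1 < β) (hr : 0 ≤ r) (n : ℕ) (g : ℝ → ℝ) (a b : ℝ)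
    (hg : SlowAt β n g) (h0 : 0 ≤ a) (hab : a ≤ b) (h1 : b ≤ 1) :
    hitVol β (nearSet r) n g a b
      ≤ 8 * r * ((1 - β⁻¹)⁻¹ * (b - a) + (n + 1) * β⁻¹ ^ n) :=
  hitVol_le hβ (by positivity) (fun n g i h => h.branch (by linarith) n g i)
    (fun g a b hg _ _ _ => hitVol_near_zero_le hr g a b hg) n g a b hg h0 hab h1

/-- The first condition confines x to an interval of length 8r; on that interval the second is a
single hit at time l, already bounded by `hitVol_near_le`. -/
theorem hitVol_nearPair_zero_le (hβ : 1 < β) (hr : 0 ≤ r) (hs : 0 ≤ s) (l : ℕ) (g : ℝ → ℝ)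
    (a b : ℝ) (h : SlowAt β 0 g) (h0 : 0 ≤ a) (h1 : b ≤ 1) :
    hitVol β (nearPairSet β r s l) 0 g a b
      ≤ 8 * s * ((1 - β⁻¹)⁻¹ * (8 * r) + (l + 1) * β⁻¹ ^ l) := by
  have hC : 0 < (1 - β⁻¹)⁻¹ := by
    have := inv_lt_one_of_one_lt₀ hβ
    rw [inv_pos]; linarith
  rcases (hitSet β (nearPairSet β r s l) 0 g a b).eq_empty_or_nonempty with he | ⟨y, hy⟩
  · rw [hitVol, he, measureReal_empty]; positivity
  · have hr' : 0 < r := (abs_nonneg _).trans_lt hy.2.1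
    have hya := hy.1.1
    have hyb := hy.1.2
    have hsub : hitSet β (nearPairSet β r s l) 0 g a b
        ⊆ hitSet β (nearSet s) l g (max a (y - 4 * r)) (min b (y + 4 * r)) := by
      intro x hx
      have : -(4 * r) < x - y ∧ x - y < 4 * r := abs_lt.1 (abs_sub_lt_of_near h hx.2.1 hy.2.1)
      exact ⟨⟨max_le hx.1.1 (by linarith [this.1]), lt_min hx.1.2 (by linarith [this.2])⟩,
        hx.2.2⟩
    refine (measureReal_mono hsub hitSet_volume_ne_top).trans ?_
    refine (hitVol_near_le hβ hs l g _ _ (h.of_zero hβ l) (h0.trans (le_max_left _ _))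
      (max_le (le_min (hya.trans hyb.le) (by linarith)) (le_min (by linarith) (by linarith)))
      ((min_le_left _ _).trans h1)).trans ?_
    have : min b (y + 4 * r) - max a (y - 4 * r) ≤ 8 * r := by
      linarith [min_le_right b (y + 4 * r), le_max_right a (y - 4 * r)]
    gcongr

theorem hitVol_nearPair_le (hβ : 1 < β) (hr : 0 ≤ r) (hs : 0 ≤ s) (l n : ℕ) (g : ℝ → ℝ)
    (a b : ℝ) (hg : SlowAt β n g) (h0 : 0 ≤ a) (hab : a ≤ b) (h1 : b ≤ 1) :
    hitVol β (nearPairSet β r s l) n g a b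
      ≤ 8 * s * ((1 - β⁻¹)⁻¹ * (8 * r) + (l + 1) * β⁻¹ ^ l)
        * ((1 - β⁻¹)⁻¹ * (b - a) + (n + 1) * β⁻¹ ^ n) := by
  have hC : 0 < (1 - β⁻¹)⁻¹ := by
    have := inv_lt_one_of_one_lt₀ hβ
    rw [inv_pos]; linarith
  exact hitVol_le hβ (by positivity) (fun n g i h => h.branch (by linarith) n g i)
    (fun g a b hg h0 _ h1 => hitVol_nearPair_zero_le hβ hr hs l g a b hg h0 h1) n g a b hg h0 hab h1

/-- A continuous self-map of [0, 1] has a fixed point z, and |x - g x| ≤ (1 + K)|x - z|. -/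
theorem le_hitVol_near_zero {K : ℝ} (hK : 0 ≤ K) (hr0 : 0 ≤ r) (hr1 : r ≤ 1) (g : ℝ → ℝ)
    (h : LipUnit K 0 g) : r / (2 * (1 + K)) ≤ hitVol β (nearSet r) 0 g 0 1 := by
  have hcont : Continuous g :=
    (LipschitzWith.of_dist_le_mul (K := ⟨K, hK⟩) fun x y => h.2 x y).continuous
  obtain ⟨z, hz, hfix⟩ := exists_mem_Icc_isFixedPt_of_mapsTo (f := g) (a := 0) (b := 1)
    hcont.continuousOn zero_le_one (fun x _ => h.1 x)
  set δ := r / (2 * (1 + K)) with hδ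
  have hδ0 : 0 ≤ δ := by positivity
  have hrδ : r = 2 * ((1 + K) * δ) := by rw [hδ]; field_simp
  have hδ1 : δ ≤ 1 / 2 := by nlinarith
  have hnear : ∀ x, |x - z| < δ → |x - g x| < r := by
    intro x hx
    have h1 := h.2 z x
    have h2 : |x - g x| ≤ |x - z| + |g z - g x| := by
      calc |x - g x| = |(x - z) + (g z - g x)| := by rw [hfix.eq]; ring_nf
        _ ≤ _ := abs_add_le _ _
    rw [abs_sub_comm z x] at h1
    nlinarith [abs_nonneg (x - z)]
  -- Since δ ≤ 1/2, a one-sided interval of length δ at z fits into [0, 1], on the side away from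
  -- the nearer endpoint.
  obtain ⟨p, hp0, hp1, hp⟩ : ∃ p, 0 ≤ p ∧ p + δ ≤ 1 ∧ ∀ x ∈ Ioo p (p + δ), |x - z| < δ := by
    rcases le_total z (1 / 2) with h | h
    · exact ⟨z, hz.1, by linarith, fun x hx => abs_lt.2
        ⟨by linarith [hx.1], by linarith [hx.2]⟩⟩
    · exact ⟨z - δ, by linarith, by linarith [hz.2], fun x hx => abs_lt.2
        ⟨by linarith [hx.1], by linarith [hx.2, hx.1]⟩⟩
  have hsub : Ioo p (p + δ) ⊆ hitSet β (nearSet r) 0 g 0 1 := fun x hx =>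
    ⟨⟨by linarith [hx.1], by linarith [hx.2]⟩, hnear x (hp x hx)⟩
  have := measureReal_mono (μ := volume) hsub hitSet_volume_ne_top
  rw [Real.volume_real_Ioo_of_le (by linarith)] at this
  unfold hitVol
  linarith

theorem exists_le_hitVol_near (hβ : 1 < β) : ∃ m : ℝ, 0 < m ∧
    ∀ (K r : ℝ), 0 ≤ K → 0 ≤ r → r ≤ 1 →
    ∀ (n : ℕ) (g : ℝ → ℝ) (a b : ℝ), LipUnit K n g → 0 ≤ a → a ≤ b → b ≤ 1 →
      r / (2 * (1 + K)) * (m * (b - a) - (n + 1) * β⁻¹ ^ n) ≤ hitVol β (nearSet r) n g a b := by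
  obtain ⟨m, hm, h⟩ := exists_le_hitVol hβ
  refine ⟨m, hm, fun K r hK h0 h1 => h (nearSet r) (LipUnit K) _ (by positivity)
    (fun n g i h => h.branch hβ hK n g i) fun g hg => le_hitVol_near_zero hK h0 h1 g hg⟩

end targets

/-! ### Chung–Erdős, Lebesgue density and the divergence criterion -/

section zeroOne

/-- A form of the Chung–Erdős inequality. -/
theorem two_mul_sum_measureReal_le {α : Type*} [MeasurableSpace α] (ν : Measure α)
    [IsFiniteMeasure ν] {A : ℕ → Set α} (hA : ∀ n, MeasurableSet (A n)) (s : Finset ℕ) (t : ℝ) :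
    2 * t * ∑ n ∈ s, ν.real (A n)
      ≤ t ^ 2 * ν.real (⋃ n ∈ s, A n) + ∑ m ∈ s, ∑ n ∈ s, ν.real (A m ∩ A n) := by
  set U := ⋃ n ∈ s, A n
  have hU : MeasurableSet U := Finset.measurableSet_biUnion _ fun n _ => hA n
  have hint : ∀ {B : Set α}, MeasurableSet B → Integrable (B.indicator (1 : α → ℝ)) ν :=
    fun hB => (integrable_const (1 : ℝ)).indicator hB
  have e1 : ∑ n ∈ s, ν.real (A n) = ∫ x, ∑ n ∈ s, (A n).indicator (1 : α → ℝ) x ∂ν := by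
    rw [integral_finsetSum _ fun n _ => hint (hA n)]
    exact Finset.sum_congr rfl fun n _ => (integral_indicator_one (hA n)).symm
  have e2 : ∑ m ∈ s, ∑ n ∈ s, ν.real (A m ∩ A n)
      = ∫ x, ∑ m ∈ s, ∑ n ∈ s, (A m ∩ A n).indicator (1 : α → ℝ) x ∂ν := by
    rw [integral_finsetSum _ fun m _ => integrable_finsetSum _ fun n _ => hint ((hA m).inter (hA n))]
    refine Finset.sum_congr rfl fun m _ => ?_
    rw [integral_finsetSum _ fun n _ => hint ((hA m).inter (hA n))]
    exact Finset.sum_congr rfl fun n _ => (integral_indicator_one ((hA m).inter (hA n))).symm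
  rw [e1, e2, ← integral_indicator_one hU, ← integral_const_mul, ← integral_const_mul,
    ← integral_add ((hint hU).const_mul _) (integrable_finsetSum _ fun m _ =>
      integrable_finsetSum _ fun n _ => hint ((hA m).inter (hA n)))]
  refine integral_mono ((integrable_finsetSum _ fun n _ => hint (hA n)).const_mul _)
    (((hint hU).const_mul _).add (integrable_finsetSum _ fun m _ =>
      integrable_finsetSum _ fun n _ => hint ((hA m).inter (hA n)))) fun x => ?_
  have e3 : ∑ m ∈ s, ∑ n ∈ s, (A m ∩ A n).indicator (1 : α → ℝ) x
      = (∑ n ∈ s, (A n).indicator (1 : α → ℝ) x) ^ 2 := by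
    rw [sq, Finset.sum_mul_sum]
    exact Finset.sum_congr rfl fun m _ => Finset.sum_congr rfl fun n _ => by
      rw [inter_indicator_one]; rfl
  simp only [e3]
  -- With X the number of n in `s` with x ∈ `A n`, this is (t - X)² ≥ 0 on U, and X = 0 off U.
  by_cases hx : x ∈ U
  · simp only [indicator_of_mem hx, Pi.one_apply]
    nlinarith [sq_nonneg (t - ∑ n ∈ s, (A n).indicator (1 : α → ℝ) x)]
  · have : ∑ n ∈ s, (A n).indicator (1 : α → ℝ) x = 0 :=
      Finset.sum_eq_zero fun n hn => indicator_of_notMem (fun h => hx (mem_biUnion hn h)) _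
    simp [this, hx]

/-- A set that has a fixed proportion of every interval has full measure. -/
theorem volume_Icc_sdiff_eq_zero {U : Set ℝ} (hU : MeasurableSet U) {δ : ℝ} (hδ : 0 < δ)
    (h : ∀ a b, 0 ≤ a → a < b → b ≤ 1 → δ * (b - a) ≤ volume.real (U ∩ Ico a b)) :
    volume (Icc 0 1 \ U) = 0 := by
  have hae := Besicovitch.ae_tendsto_measure_inter_div_of_measurableSet volume hU
  have h01 : ∀ᵐ x : ℝ, x ≠ 0 ∧ x ≠ 1 := by
    filter_upwards [Measure.ae_ne volume (0 : ℝ), Measure.ae_ne volume (1 : ℝ)] with x h0 h1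
    exact ⟨h0, h1⟩
  suffices ∀ᵐ x : ℝ, x ∉ Icc (0 : ℝ) 1 \ U from measure_eq_zero_iff_ae_notMem.2 this
  filter_upwards [hae, h01] with x hx hx01 hmem
  obtain ⟨⟨h0, h1⟩, hxU⟩ := hmem
  have h0' : 0 < x := lt_of_le_of_ne h0 (Ne.symm hx01.1)
  have h1' : x < 1 := lt_of_le_of_ne h1 hx01.2
  -- The density of U at x would be 0, while every small ball around x meets U in proportion at
  -- least δ.
  rw [indicator_of_notMem hxU] at hx
  have hev : ∀ᶠ r in nhdsWithin (0 : ℝ) (Ioi 0), ENNReal.ofReal δ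
      ≤ volume (U ∩ Metric.closedBall x r) / volume (Metric.closedBall x r) := by
    filter_upwards [Ioo_mem_nhdsGT (lt_min h0' (sub_pos.2 h1'))] with r hr
    have hr0 := hr.1
    have hr1 := hr.2.trans_le (min_le_left _ _)
    have hr2 := hr.2.trans_le (min_le_right _ _)
    rw [Real.volume_closedBall, ENNReal.le_div_iff_mul_le (Or.inl (by simpa using hr0))
      (Or.inl ENNReal.ofReal_ne_top), ← ENNReal.ofReal_mul hδ.le]
    have hI := h (x - r) (x + r) (by linarith) (by linarith) (by linarith)
    rw [show x + r - (x - r) = 2 * r by ring] at hI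
    refine (ENNReal.ofReal_le_ofReal hI).trans ?_
    rw [measureReal_def]
    refine ENNReal.ofReal_toReal_le.trans (measure_mono ?_)
    rw [Real.closedBall_eq_Icc]
    exact inter_subset_inter_right _ Ico_subset_Icc_self
  have := ge_of_tendsto hx hev
  simp only [nonpos_iff_eq_zero, ENNReal.ofReal_eq_zero] at this
  linarith

/-- Quasi-independence on each interval suffices even though the threshold `n₀` depends on the
interval: the proportion obtained, c²/E, does not. -/
theorem volume_Icc_sdiff_frequently_eq_zero {A : ℕ → Set ℝ} (hA : ∀ n, MeasurableSet (A n))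
    {φ e : ℕ → ℝ} (hφ0 : ∀ n, 1 ≤ n → 0 < φ n) (hφ : ¬ Summable φ) (he0 : ∀ n, 0 ≤ e n)
    (he : Summable e) {c D : ℝ} (hc : 0 < c) (hD : 0 < D)
    (h : ∀ a b, 0 ≤ a → a < b → b ≤ 1 → ∃ n₀,
      (∀ n, n₀ ≤ n → c * φ n * (b - a) ≤ volume.real (A n ∩ Ico a b)) ∧
      ∀ m l, n₀ ≤ m → volume.real (A m ∩ A (m + l) ∩ Ico a b)
        ≤ D * φ (m + l) * (φ m + e l) * (b - a)) :
    volume (Icc 0 1 \ {x | ∃ᶠ n in atTop, x ∈ A n}) = 0 := by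
  set S := ∑' n, e n
  have hS : 0 ≤ S := tsum_nonneg he0
  set E := D * (1 + 2 * S) with hE
  have hE0 : 0 < E := by positivity
  have htail : ∀ M, 1 ≤ M → ∃ N, 1 ≤ ∑ n ∈ Finset.Ico M N, φ n := by
    intro M hM
    have hns : ¬ Summable fun n => φ (n + M) := by rwa [summable_nat_add_iff]
    have ht := (not_summable_iff_tendsto_nat_atTop_of_nonneg
      fun n => (hφ0 (n + M) (by omega)).le).1 hns
    obtain ⟨k, hk⟩ := (ht.eventually_ge_atTop 1).exists
    refine ⟨M + k, ?_⟩
    rw [Finset.sum_Ico_eq_sum_range]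
    simpa [add_comm] using hk
  have hlocal : ∀ M a b, 0 ≤ a → a < b → b ≤ 1 →
      c ^ 2 / E * (b - a) ≤ volume.real ((⋃ n ∈ Ici M, A n) ∩ Ico a b) := by
    intro M a b h0 hab h1
    obtain ⟨n₀, hlow, hpair⟩ := h a b h0 hab h1
    -- Index 0 is avoided because `φ 0` has no prescribed sign.
    set M' := max (max M n₀) 1
    have hM1 : 1 ≤ M' := le_max_right _ _
    have hMM : M ≤ M' := (le_max_left _ _).trans (le_max_left _ _)
    have hMn : n₀ ≤ M' := (le_max_right _ _).trans (le_max_left _ _)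
    obtain ⟨N, hN⟩ := htail M' hM1
    set s := Finset.Ico M' N
    set P := ∑ n ∈ s, φ n
    have hs : ∀ n ∈ s, M' ≤ n := fun n hn => (Finset.mem_Ico.1 hn).1
    have hpos : ∀ n ∈ s, 0 ≤ φ n := fun n hn => (hφ0 n (hM1.trans (hs n hn))).le
    set ν := volume.restrict (Ico a b)
    have hν : ∀ B, MeasurableSet B → ν.real B = volume.real (B ∩ Ico a b) := fun B hB => by
      rw [measureReal_def, measureReal_def, Measure.restrict_apply hB]
    have hl : 0 < b - a := sub_pos.2 hab
    have q1 : c * (b - a) * P ≤ ∑ n ∈ s, ν.real (A n) := by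
      rw [Finset.mul_sum]
      refine Finset.sum_le_sum fun n hn => ?_
      rw [hν _ (hA n)]
      refine le_trans (le_of_eq (by ring)) (hlow n (hMn.trans (hs n hn)))
    have hq : ∀ m ∈ s, ∀ n ∈ s, ν.real (A m ∩ A n) ≤ D * (b - a) * (φ m * φ n
        + (if m ≤ n then φ n * e (n - m) else 0) + (if n ≤ m then φ m * e (m - n) else 0)) := by
      have hle : ∀ m ∈ s, ∀ n ∈ s, m ≤ n → ν.real (A m ∩ A n)
          ≤ D * (b - a) * (φ m * φ n + φ n * e (n - m)) := by
        intro m hm n hn hmn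
        rw [hν _ ((hA m).inter (hA n))]
        have := hpair m (n - m) (hMn.trans (hs m hm))
        rw [Nat.add_sub_cancel' hmn] at this
        exact this.trans (le_of_eq (by ring))
      intro m hm n hn
      have hDl : 0 ≤ D * (b - a) := by positivity
      have p1 := mul_nonneg (hpos m hm) (he0 (m - n))
      have p2 := mul_nonneg (hpos n hn) (he0 (n - m))
      rcases le_total m n with hmn | hmn
      · refine (hle m hm n hn hmn).trans (mul_le_mul_of_nonneg_left ?_ hDl)
        rw [if_pos hmn]
        split_ifs <;> linarith
      · rw [inter_comm]
        refine (hle n hn m hm hmn).trans (mul_le_mul_of_nonneg_left ?_ hDl)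
        rw [if_pos hmn, mul_comm (φ n)]
        split_ifs <;> linarith
    have hsum : ∑ n ∈ s, ∑ m ∈ s, (if m ≤ n then φ n * e (n - m) else 0) ≤ P * S := by
      rw [Finset.sum_mul]
      refine Finset.sum_le_sum fun n hn => ?_
      rw [← Finset.sum_filter, ← Finset.mul_sum]
      refine mul_le_mul_of_nonneg_left ?_ (hpos n hn)
      -- For fixed n the gaps n - m are distinct, so the sum of the e(n - m) is at most S.
      rw [← Finset.sum_image (f := e) (g := fun m => n - m) (s := s.filter (· ≤ n))]
      · exact he.sum_le_tsum _ fun i _ => he0 i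
      · intro x hx y hy hxy
        simp only [Finset.coe_filter, mem_ofPred_eq] at hx hy
        have := hx.2; have := hy.2
        simp only at hxy
        omega
    have q2 : ∑ m ∈ s, ∑ n ∈ s, ν.real (A m ∩ A n) ≤ E * (b - a) * P ^ 2 := by
      calc ∑ m ∈ s, ∑ n ∈ s, ν.real (A m ∩ A n)
          ≤ ∑ m ∈ s, ∑ n ∈ s, D * (b - a) * (φ m * φ n
            + (if m ≤ n then φ n * e (n - m) else 0) + (if n ≤ m then φ m * e (m - n) else 0)) :=
            Finset.sum_le_sum fun m hm => Finset.sum_le_sum fun n hn => hq m hm n hn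
        _ = D * (b - a) * (P ^ 2
            + ∑ n ∈ s, ∑ m ∈ s, (if m ≤ n then φ n * e (n - m) else 0)
            + ∑ n ∈ s, ∑ m ∈ s, (if m ≤ n then φ n * e (n - m) else 0)) := by
            simp only [← Finset.mul_sum, Finset.sum_add_distrib]
            rw [Finset.sum_comm (f := fun m n => if m ≤ n then φ n * e (n - m) else 0), sq,
              ← Finset.sum_mul]
        _ ≤ D * (b - a) * (P ^ 2 + P * S + P * S) := by gcongr
        _ ≤ D * (b - a) * (P ^ 2 + P ^ 2 * S + P ^ 2 * S) := by
            -- The block was chosen with P ≥ 1 so that the linear terms are absorbed.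
            have : P ≤ P ^ 2 := by nlinarith
            gcongr
        _ = _ := by rw [hE]; ring
    -- t = E P / c maximises the resulting lower bound for the union, giving (c²/E)(b - a).
    have q3 := two_mul_sum_measureReal_le ν hA s (E / c * P)
    have hV : ν.real (⋃ n ∈ s, A n) ≤ volume.real ((⋃ n ∈ Ici M, A n) ∩ Ico a b) := by
      rw [hν _ (Finset.measurableSet_biUnion _ fun n _ => hA n)]
      refine measureReal_mono (inter_subset_inter_left _ ?_)
        ((measure_mono inter_subset_right).trans_lt measure_Ico_lt_top).ne
      exact biUnion_subset_biUnion_left fun n hn => hMM.trans (hs n hn)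
    refine le_trans ?_ hV
    set V := ν.real (⋃ n ∈ s, A n)
    have hP : 0 < P := by linarith
    have q4 : 2 * (E / c * P) * (c * (b - a) * P)
        ≤ (E / c * P) ^ 2 * V + E * (b - a) * P ^ 2 :=
      (mul_le_mul_of_nonneg_left q1 (by positivity)).trans (q3.trans (by gcongr))
    have e1 : 2 * (E / c * P) * (c * (b - a) * P) = 2 * (E * (b - a) * P ^ 2) := by
      field_simp
    have e2 : E * (b - a) * P ^ 2 = (E / c * P) ^ 2 * (c ^ 2 / E * (b - a)) := by
      field_simp
    have q5 : (E / c * P) ^ 2 * (c ^ 2 / E * (b - a)) ≤ (E / c * P) ^ 2 * V := by linarith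
    exact le_of_mul_le_mul_left q5 (by positivity)
  have hfull : ∀ M, volume (Icc 0 1 \ ⋃ n ∈ Ici M, A n) = 0 := fun M =>
    volume_Icc_sdiff_eq_zero (MeasurableSet.biUnion (to_countable _) fun n _ => hA n)
      (by positivity) (hlocal M)
  refine measure_mono_null ?_ (measure_iUnion_null hfull)
  rintro x ⟨hx, hxn⟩
  simp only [mem_ofPred_eq, not_frequently, eventually_atTop] at hxn
  obtain ⟨M, hM⟩ := hxn
  refine mem_iUnion.2 ⟨M, hx, fun hmem => ?_⟩
  simp only [mem_iUnion] at hmem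
  obtain ⟨n, hn, hxA⟩ := hmem
  exact hM n hn hxA

end zeroOne

/-! ### The two halves of the dichotomy -/

section main

variable {β : ℝ} {g : ℝ → ℝ} {φ : ℕ → ℝ}

theorem measurable_betaMap (β : ℝ) : Measurable (betaMap β) := by
  unfold betaMap
  fun_prop

theorem measurableSet_hitSet {D : Set (ℝ × ℝ)} (hD : MeasurableSet D) (hg : Measurable g)
    (n : ℕ) (a b : ℝ) : MeasurableSet (hitSet β D n g a b) :=
  measurableSet_Ico.inter
    ((((measurable_betaMap β).iterate n).prodMk hg) hD)

theorem measurableSet_nearSet (r : ℝ) : MeasurableSet (nearSet r) :=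
  measurableSet_lt (by fun_prop) measurable_const

theorem summable_succ_mul_inv_pow (hβ : 1 < β) :
    Summable fun n : ℕ => ((n : ℝ) + 1) * β⁻¹ ^ n := by
  have h1 : β⁻¹ < 1 := inv_lt_one_of_one_lt₀ hβ
  have h0 : 0 ≤ β⁻¹ := by positivity
  have h2 := summable_pow_mul_geometric_of_norm_lt_one (R := ℝ) 1
    (r := β⁻¹) (by rwa [Real.norm_of_nonneg h0])
  simpa [add_mul] using h2.add (summable_geometric_of_lt_one h0 h1)

theorem eventually_slowAt (hβ : 1 < β) {K : ℝ} (hg : ∀ x y, |g x - g y| ≤ K * |x - y|) :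
    ∀ᶠ n in atTop, SlowAt β n g := by
  filter_upwards [(tendsto_pow_atTop_atTop_of_one_lt hβ).eventually_ge_atTop (2 * K)] with n hn x y
  refine (hg x y).trans ?_
  gcongr
  linarith

theorem volume_frequently_near_eq_zero (hβ : 1 < β) {K : ℝ}
    (hg : ∀ x y, |g x - g y| ≤ K * |x - y|) (hφ : ∀ n, 1 ≤ n → 0 < φ n) (hs : Summable φ) :
    volume {x | ∃ᶠ n in atTop, x ∈ hitSet β (nearSet (φ n)) n g 0 1} = 0 := by
  have he := summable_succ_mul_inv_pow hβ
  have he0 : ∀ n : ℕ, 0 ≤ ((n : ℝ) + 1) * β⁻¹ ^ n := fun n => by positivity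
  have hsum : Summable fun n => hitVol β (nearSet (φ n)) n g 0 1 := by
    refine Summable.of_norm_bounded_eventually_nat (hs.mul_left
      (8 * ((1 - β⁻¹)⁻¹ + ∑' n : ℕ, ((n : ℝ) + 1) * β⁻¹ ^ n))) ?_
    filter_upwards [eventually_slowAt hβ hg, eventually_ge_atTop 1] with n hn h1
    rw [Real.norm_of_nonneg hitVol_nonneg]
    have hp := (hφ n h1).le
    refine (hitVol_near_le hβ hp n g 0 1 hn le_rfl zero_le_one le_rfl).trans ?_
    have := he.le_tsum n fun j _ => he0 j
    calc 8 * φ n * ((1 - β⁻¹)⁻¹ * (1 - 0) + (n + 1) * β⁻¹ ^ n)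
        = 8 * ((1 - β⁻¹)⁻¹ + (n + 1) * β⁻¹ ^ n) * φ n := by ring
      _ ≤ _ := by gcongr
  have h := hsum.tsum_ofReal_ne_top
  simp only [ofReal_hitVol] at h
  exact measure_setOfPred_frequently_eq_zero
    (p := fun n x => x ∈ hitSet β (nearSet (φ n)) n g 0 1) h

theorem hitSet_inter_Ico {D : Set (ℝ × ℝ)} {n : ℕ} {a b : ℝ} (h0 : 0 ≤ a) (h1 : b ≤ 1) :
    hitSet β D n g 0 1 ∩ Ico a b = hitSet β D n g a b := by
  ext x
  constructor
  · rintro ⟨⟨-, h⟩, hx⟩; exact ⟨hx, h⟩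
  · rintro ⟨hx, h⟩; exact ⟨⟨⟨h0.trans hx.1, hx.2.trans_le h1⟩, h⟩, hx⟩

theorem volume_Icc_sdiff_frequently_near_eq_zero (hβ : 1 < β) {K : ℝ} (hK : 0 ≤ K)
    (hg : ∀ n, LipUnit K n g) (hφ : ∀ n, 1 ≤ n → φ n ∈ Ioc (0 : ℝ) 1) (hs : ¬ Summable φ) :
    volume (Icc 0 1 \ {x | ∃ᶠ n in atTop, x ∈ hitSet β (nearSet (φ n)) n g 0 1}) = 0 := by
  have he := summable_succ_mul_inv_pow hβ
  have he0 : ∀ n : ℕ, 0 ≤ ((n : ℝ) + 1) * β⁻¹ ^ n := fun n => by positivity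
  have hcont : Continuous g :=
    (LipschitzWith.of_dist_le_mul (K := ⟨K, hK⟩) fun x y => (hg 0).2 x y).continuous
  obtain ⟨m, hm, hlow⟩ := exists_le_hitVol_near hβ
  have hC1 : 1 ≤ (1 - β⁻¹)⁻¹ := by
    have h1 := inv_lt_one_of_one_lt₀ hβ
    have h0 : 0 < β⁻¹ := by positivity
    exact one_le_inv₀ (by linarith) |>.2 (by linarith)
  set C := (1 - β⁻¹)⁻¹
  refine volume_Icc_sdiff_frequently_eq_zero
    (fun n => measurableSet_hitSet (measurableSet_nearSet _) hcont.measurable n 0 1)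
    (fun n hn => (hφ n hn).1) hs he0 he
    -- c keeps half of the lower bound after the error is absorbed; 128 C² is 8 · 8C · 2C from the
    -- pair estimate.
    (c := m / (4 * (1 + K))) (D := 128 * C ^ 2) (by positivity) (by positivity) ?_
  intro a b h0 hab h1
  have hl : 0 < b - a := sub_pos.2 hab
  have hev : ∀ᶠ n : ℕ in atTop, ((n : ℝ) + 1) * β⁻¹ ^ n ≤ min (m / 2) C * (b - a) :=
    he.tendsto_atTop_zero.eventually_le_const (mul_pos (lt_min (by positivity) (by positivity)) hl)
  obtain ⟨n₀, hn₀⟩ := eventually_atTop.1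
    ((hev.and (eventually_slowAt hβ (hg 0).2)).and (eventually_ge_atTop 1))
  refine ⟨n₀, fun n hn => ?_, fun n l hn => ?_⟩
  · obtain ⟨⟨h2, -⟩, h3⟩ := hn₀ n hn
    rw [hitSet_inter_Ico h0 h1]
    have hp := hφ n h3
    refine le_trans ?_ (hlow K (φ n) hK hp.1.le hp.2 n g a b (hg n) h0 hab.le h1)
    have h4 : ((n : ℝ) + 1) * β⁻¹ ^ n ≤ m / 2 * (b - a) :=
      h2.trans (mul_le_mul_of_nonneg_right (min_le_left _ _) hl.le)
    have h5 : 0 ≤ φ n / (2 * (1 + K)) := div_nonneg hp.1.le (by positivity)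
    calc m / (4 * (1 + K)) * φ n * (b - a) = φ n / (2 * (1 + K)) * (m / 2 * (b - a)) := by
          field_simp; ring
      _ ≤ _ := mul_le_mul_of_nonneg_left (by linarith) h5
  · obtain ⟨⟨h2, hslow⟩, h3⟩ := hn₀ n hn
    have hp := (hφ n h3).1.le
    have hq := (hφ (n + l) (by omega)).1.le
    have hsub : hitSet β (nearSet (φ n)) n g 0 1 ∩ hitSet β (nearSet (φ (n + l))) (n + l) g 0 1
        ∩ Ico a b ⊆ hitSet β (nearPairSet β (φ n) (φ (n + l)) l) n g a b := by
      rintro x ⟨⟨hx1, hx2⟩, hx⟩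
      refine ⟨hx, hx1.2, ?_⟩
      have := hx2.2
      rwa [add_comm n l, Function.iterate_add_apply, nearSet, mem_ofPred_eq, add_comm l n] at this
    refine (measureReal_mono hsub hitSet_volume_ne_top).trans ?_
    refine (hitVol_nearPair_le hβ hp hq l n g a b hslow h0 hab.le h1).trans ?_
    have h4 : ((n : ℝ) + 1) * β⁻¹ ^ n ≤ C * (b - a) :=
      h2.trans (mul_le_mul_of_nonneg_right (min_le_right _ _) hl.le)
    have h5 : C * (8 * φ n) + (l + 1) * β⁻¹ ^ l ≤ 8 * C * (φ n + (l + 1) * β⁻¹ ^ l) := by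
      nlinarith [he0 l]
    have h6 := he0 l
    calc 8 * φ (n + l) * (C * (8 * φ n) + (l + 1) * β⁻¹ ^ l)
          * (C * (b - a) + (n + 1) * β⁻¹ ^ n)
        ≤ 8 * φ (n + l) * (8 * C * (φ n + (l + 1) * β⁻¹ ^ l))
          * (C * (b - a) + C * (b - a)) := by gcongr
      _ = _ := by ring

/-- Half-open intervals omit only the null point 1, and index 0 cannot affect occurring infinitely
often. -/
theorem recurrenceSet_ae_eq {L : ℝ → ℝ} (hgL : ∀ x ∈ Icc (0 : ℝ) 1, g x = L x) :
    recurrenceSet β L φ =ᵐ[volume]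
      {x | ∃ᶠ n in atTop, x ∈ hitSet β (nearSet (φ n)) n g 0 1} := by
  filter_upwards [Measure.ae_ne volume (1 : ℝ)] with x hx
  refine propext ?_
  change x ∈ recurrenceSet β L φ ↔ ∃ᶠ n in atTop, x ∈ hitSet β (nearSet (φ n)) n g 0 1
  rw [recurrenceSet, mem_ofPred_eq, ← Nat.frequently_atTop_iff_infinite]
  constructor
  · rintro ⟨hmem, h⟩
    refine h.mono fun n hn => ⟨⟨hmem.1, lt_of_le_of_ne hmem.2 hx⟩, ?_⟩
    rw [nearSet, mem_ofPred_eq, hgL x hmem]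
    exact hn.2
  · intro h
    obtain ⟨n, hn⟩ := h.exists
    have hmem : x ∈ Icc (0 : ℝ) 1 := Ico_subset_Icc_self hn.1
    refine ⟨hmem, (h.and_eventually (eventually_ge_atTop 1)).mono fun n hn => ⟨hn.2, ?_⟩⟩
    rw [← hgL x hmem]
    exact hn.1.2

end main

theorem theorem1p6 (β : ℝ) (hβ : 1 < β)
    (L : ℝ → ℝ) (hLmaps : MapsTo L (Icc 0 1) (Icc 0 1))
    (K : ℝ≥0) (hL : LipschitzOnWith K L (Icc 0 1))
    (φ : ℕ → ℝ) (hφ : ∀ n, 1 ≤ n → φ n ∈ Ioc (0 : ℝ) 1) :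
    NullMeasurableSet (recurrenceSet β L φ) volume ∧
    (Summable φ → volume (recurrenceSet β L φ) = 0) ∧
    (¬ Summable φ → volume (recurrenceSet β L φ) = 1) := by
  -- Branch substitutions with arbitrary i leave [0, 1], so L is extended to the line by projection,
  -- keeping its range and Lipschitz constant.
  set g : ℝ → ℝ := fun x => L (projIcc 0 1 zero_le_one x) with hgdef
  have hgL : ∀ x ∈ Icc (0 : ℝ) 1, g x = L x := fun x hx => by
    simp only [hgdef, projIcc_of_mem zero_le_one hx]
  have hg : ∀ n, LipUnit K n g := fun n =>
    ⟨fun x => hLmaps (projIcc 0 1 zero_le_one x).2, fun x y => by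
      have h1 := hL.dist_le_mul _ (projIcc 0 1 zero_le_one x).2 _ (projIcc 0 1 zero_le_one y).2
      have h2 := (LipschitzWith.projIcc (zero_le_one (α := ℝ))).dist_le_mul x y
      rw [NNReal.coe_one, one_mul] at h2
      exact h1.trans (mul_le_mul_of_nonneg_left h2 K.2)⟩
  have hmeas : Measurable g :=
    (LipschitzWith.of_dist_le_mul (K := K) fun x y => (hg 0).2 x y).continuous.measurable
  have hae := recurrenceSet_ae_eq (β := β) (φ := φ) hgL
  set F := {x | ∃ᶠ n in atTop, x ∈ hitSet β (nearSet (φ n)) n g 0 1} with hF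
  have hFm : MeasurableSet F := by
    have : F = limsup (fun n => hitSet β (nearSet (φ n)) n g 0 1) atTop := by
      ext x
      rw [mem_limsup_iff_frequently_mem]
      rfl
    rw [this]
    exact MeasurableSet.measurableSet_limsup fun n =>
      measurableSet_hitSet (measurableSet_nearSet _) hmeas n 0 1
  refine ⟨hFm.nullMeasurableSet.congr hae.symm, fun hs => ?_, fun hs => ?_⟩
  · rw [measure_congr hae]
    exact volume_frequently_near_eq_zero hβ (hg 0).2 (fun n hn => (hφ n hn).1) hs
  · rw [measure_congr hae]
    have hsub : F ⊆ Icc 0 1 := fun x hx => by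
      obtain ⟨n, hn⟩ := Frequently.exists hx
      exact Ico_subset_Icc_self hn.1
    have h0 := volume_Icc_sdiff_frequently_near_eq_zero hβ K.2 hg hφ hs
    have h1 := measure_inter_add_sdiff (μ := volume) (Icc (0 : ℝ) 1) hFm
    rw [h0, add_zero, inter_eq_self_of_subset_right hsub] at h1
    simpa using h1
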